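/- Let $n\ge 5$ be a prime, $[k]=\{0,\dots,k-1\}$, and consider complete directed graphs with self loops on the nodes $v_0,\dots,v_{n-1}$, each given by a binary labeling $L:\{v_0,\dots,v_{n-1}\}^2\to\mathbb F_2$ of its $n^2$ edges, where $L(v_i,v_j)$ is the bit stored on the edge from $v_i$ to $v_j$. For unordered pairs put, for $h\in[n-2]$ and $m\in[n]$, $$S_h=\{\langle v_h,v_\ell\rangle : \ell\in[n-1]\},\qquad S'_h=\{\langle v_h,v_\ell\rangle : \ell\in[n]\setminus\{n-2\}\},$$ $$D_m=\{\langle v_k,v_\ell\rangle : k,\ell\in[n]\setminus\{n-2\},\ k+\ell\equiv m \ (\mathrm{mod}\ n)\}\cup\{\langle v_{n-1},v_{n-2}\rangle\},$$ $$D'_m=\{\langle v_k,v_\ell\rangle : k,\ell\in[n-1],\ k+\ell\equiv m\ (\mathrm{mod}\ n)\}\cup\{\langle v_{n-2},v_{n-1}\rangle\}.$$ Let $\langle v_i,v_j\rangle^{\downarrow}=(v_{\max\{i,j\}},v_{\min\{i,j\}})$ and $\langle v_i,v_j\rangle^{\uparrow}=(v_{\min\{i,j\}},v_{\max\{i,j\}})$,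 and let $S^\downarrow_h,D^\downarrow_m$ be the images of $S_h,D_m$ under $\downarrow$ and $S^\uparrow_h,D^\uparrow_m$ the images of $S'_h,D'_m$ under $\uparrow$. Let $\mathcal C_{\mathcal G_4}$ be the set of all graphs whose labeling $L$ satisfies $$\sum_{e\in S^\downarrow_h}L(e)=0,\quad \sum_{e\in S^\uparrow_h}L(e)=0\ \ (h\in[n-2]),\qquad \sum_{e\in D^\downarrow_m}L(e)=0,\quad \sum_{e\in D^\uparrow_m}L(e)=0\ \ (m\in[n]).$$ A set $\mathcal C$ of such labeled graphs (a code) is $\rho$-node-erasure-correcting if for every set of $\rho$ nodes, each graph $G\in\mathcal C$ can be recovered after the labels of all edges entering or leaving these nodes have been erased. The dimension of $\mathcal C$ is $\log_2|\mathcal C|$ and its redundancy is $n^2-\log_2|\mathcal C|$. A $\rho$-node-erasure-correcting code has redundancy at least $n^2-(n-\rho)^2$, and it is called optimal if equality holds. **Theorem.** For every prime $n\ge5$, $\mathcal C_{\mathcal G_4}$ is an optimal double-node-erasure-correcting code (that is, optimal for $\rho=2$). In particular its redundancy is $4n-4$ and its dimension is $(n-2)^2$. -/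

import Mathlib

namespace GraphCode

/-- A complete directed graph with self loops on the nodes `v_0, …, v_{n-1}`, given by its
labeling function: `L (i, j)` is the symbol stored on the edge from `v_i` to `v_j`. -/
abbrev LabeledGraph (n : ℕ) (α : Type*) := Fin n × Fin n → α

/-- The neighborhood set of a node: all its outgoing and incoming edges. -/
def neighborhood {n : ℕ} (i : Fin n) : Finset (Fin n × Fin n) :=
  Finset.univ.image (fun j => (i, j)) ∪ Finset.univ.image (fun j => (j, i))

/-- The graph `G` after the failure of the nodes in `F`: the symbols on all the edges in the
neighborhood sets of the failed nodes are erased (`none`), the others are kept. -/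
def fail {n : ℕ} {α : Type*} (F : Finset (Fin n)) (G : LabeledGraph n α) :
    LabeledGraph n (Option α) :=
  fun e => if e ∈ F.biUnion neighborhood then none else some (G e)

/-- A code over graphs (a set of labeled graphs) is `ρ`-node-erasure-correcting if for any `ρ`
failed nodes there is a decoder that recovers every graph of the code from what is left. -/
def IsNodeErasureCorrecting {n : ℕ} {α : Type*} (ρ : ℕ) (C : Set (LabeledGraph n α)) : Prop :=
  ∀ F : Finset (Fin n), F.card = ρ →
    ∃ decode : LabeledGraph n (Option α) → LabeledGraph n α, ∀ G ∈ C, decode (fail F G) = G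

/-- The dimension `log_{|α|} |C|` of a code over graphs. -/
noncomputable def dimension {n : ℕ} {α : Type*} (C : Set (LabeledGraph n α)) : ℝ :=
  Real.logb (Nat.card α) C.ncard

/-- The redundancy `n² - log_{|α|} |C|` of a code over graphs. -/
noncomputable def redundancy {n : ℕ} {α : Type*} (C : Set (LabeledGraph n α)) : ℝ :=
  (n : ℝ) ^ 2 - dimension C

/-- An optimal `ρ`-node-erasure-correcting code: its redundancy meets the lower bound
`n² - (n - ρ)²` with equality. -/
def IsOptimalNodeErasureCorrecting {n : ℕ} {α : Type*} (ρ : ℕ)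
    (C : Set (LabeledGraph n α)) : Prop :=
  IsNodeErasureCorrecting ρ C ∧ redundancy C = (n : ℝ) ^ 2 - ((n : ℝ) - ρ) ^ 2

/-- `⟨v_i, v_j⟩↓`, the edge directed from `v_{max(i,j)}` to `v_{min(i,j)}`. -/
def down {n : ℕ} (e : Sym2 (Fin n)) : Fin n × Fin n := (e.sup, e.inf)

/-- `⟨v_i, v_j⟩↑`, the edge directed from `v_{min(i,j)}` to `v_{max(i,j)}`. -/
def up {n : ℕ} (e : Sym2 (Fin n)) : Fin n × Fin n := (e.inf, e.sup)

/-- `S_h = {⟨v_h, v_l⟩ : l ∈ {0, …, n-2}}`, used for `h < n - 2`. -/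
def S {n : ℕ} (h : Fin n) : Finset (Sym2 (Fin n)) :=
  (Finset.univ.filter fun l : Fin n => (l : ℕ) < n - 1).image fun l => s(h, l)

/-- `D_m = {⟨v_k, v_l⟩ : k, l ≠ n-2, k + l ≡ m mod n} ∪ {⟨v_{n-1}, v_{n-2}⟩}`. -/
def D {n : ℕ} (m : Fin n) : Finset (Sym2 (Fin n)) :=
  ((Finset.univ.filter fun p : Fin n × Fin n =>
      (p.1 : ℕ) ≠ n - 2 ∧ (p.2 : ℕ) ≠ n - 2 ∧ ((p.1 : ℕ) + p.2) % n = m) ∪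
    (Finset.univ.filter fun p : Fin n × Fin n =>
      (p.1 : ℕ) = n - 1 ∧ (p.2 : ℕ) = n - 2)).image fun p => s(p.1, p.2)

/-- `S'_h = {⟨v_h, v_l⟩ : l ∈ {0, …, n-1}, l ≠ n-2}`, used for `h < n - 2`. -/
def S' {n : ℕ} (h : Fin n) : Finset (Sym2 (Fin n)) :=
  (Finset.univ.filter fun l : Fin n => (l : ℕ) ≠ n - 2).image fun l => s(h, l)

/-- `D'_m = {⟨v_k, v_l⟩ : k, l ∈ {0, …, n-2}, k + l ≡ m mod n} ∪ {⟨v_{n-2}, v_{n-1}⟩}`. -/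
def D' {n : ℕ} (m : Fin n) : Finset (Sym2 (Fin n)) :=
  ((Finset.univ.filter fun p : Fin n × Fin n =>
      (p.1 : ℕ) < n - 1 ∧ (p.2 : ℕ) < n - 1 ∧ ((p.1 : ℕ) + p.2) % n = m) ∪
    (Finset.univ.filter fun p : Fin n × Fin n =>
      (p.1 : ℕ) = n - 2 ∧ (p.2 : ℕ) = n - 1)).image fun p => s(p.1, p.2)

/-- The neighborhood-edge set `S↓_h`. -/
def Sdown {n : ℕ} (h : Fin n) : Finset (Fin n × Fin n) := (S h).image down

/-- The neighborhood-edge set `S↑_h`. -/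
def Sup {n : ℕ} (h : Fin n) : Finset (Fin n × Fin n) := (S' h).image up

/-- The diagonal-edge set `D↓_m`. -/
def Ddown {n : ℕ} (m : Fin n) : Finset (Fin n × Fin n) := (D m).image down

/-- The diagonal-edge set `D↑_m`. -/
def Dup {n : ℕ} (m : Fin n) : Finset (Fin n × Fin n) := (D' m).image up

/-- The binary code `C_{G_4}` over complete directed graphs with `n` nodes. -/
def codeG4 (n : ℕ) : Set (LabeledGraph n (ZMod 2)) :=
  {L | (∀ h : Fin n, (h : ℕ) < n - 2 → ∑ e ∈ Sdown h, L e = 0) ∧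
       (∀ m : Fin n, ∑ e ∈ Ddown m, L e = 0) ∧
       (∀ h : Fin n, (h : ℕ) < n - 2 → ∑ e ∈ Sup h, L e = 0) ∧
       (∀ m : Fin n, ∑ e ∈ Dup m, L e = 0)}

end GraphCode

/-!
A labeling `L` of the directed edges amounts to two labelings of the unordered pairs of nodes, the
lower half `e ↦ L (down e)` and the upper half `e ↦ L (up e)`, which agree on the loops. With
`a = n - 1` and `b = n - 2` as residues modulo `n`, the lower half satisfies the system `IsHalf a b`
of row and diagonal checks, and the upper half satisfies the same system with `a` and `b` exchanged.

By linearity, correcting the erasure of nodes `i` and `j` means that a codeword vanishing on all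
edges that avoid `i` and `j` is zero. A half on its own need not vanish: one of its symbols can
remain undetermined. That symbol is a loop, however, and the other half forces it to be zero.
If `i` and `j` avoid `a` and `b`, the row checks identify the symbols at `i` and `j` in the same
column and the diagonal checks identify them after a shift by `i - j`, so that a symbol propagates
along the progression `j + t * (i - j)`, which exhausts the residues because `n` is prime. The
propagation is interrupted only at `i`, at `j` and at `a`, and it meets a zero at `b`. Hence the order
in which `a` and `b` occur decides whether the loop at `i` or the loop at `j` is zero
(`IsHalf.loop_eq_zero_of_avoiding`), and exchanging `a` and `b` exchanges the two outcomes. The cases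
where `i` or `j` is `a` or `b` are direct; `IsHalf.eq_zero_of_coupled` puts all of them together.

The dimension then needs no independence argument for the `4 * n - 4` checks. Their number bounds
the dimension of the code from below by `(n - 2) ^ 2`, and restriction to the edges that avoid two
nodes is injective on the code, which bounds it from above by the same number.
-/

namespace GraphCode

open Finset

/-! ### The check system of one half -/

/-- The parity checks on one half of a labeling, as a labeling of unordered pairs of residues:
the rows of the nodes other than `a` and `b`, each punctured at `a`, and the diagonals, each
punctured at `b` and completed by the edge joining `a` and `b`. -/
structure IsHalf {n : ℕ} [NeZero n] (a b : ZMod n) (x : Sym2 (ZMod n) → ZMod 2) : Prop where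
  row : ∀ h, h ≠ a → h ≠ b → ∑ l ∈ univ.erase a, x s(h, l) = 0
  diag : ∀ m, ∑ e with b ∉ e ∧ e.add = m, x e + x s(a, b) = 0

/-- The labeling `x` with the edges at `b` set to zero, which is how the diagonal
checks see it, apart from the completing edge. -/
def punctured {n : ℕ} (b : ZMod n) (x : Sym2 (ZMod n) → ZMod 2) (e : Sym2 (ZMod n)) : ZMod 2 :=
  if b ∈ e then 0 else x e

/-- `x` vanishes on the edges that meet neither `i` nor `j`. -/
def SupportedAt {n : ℕ} (i j : ZMod n) (x : Sym2 (ZMod n) → ZMod 2) : Prop :=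
  ∀ e, i ∉ e → j ∉ e → x e = 0

section
variable {n : ℕ} {a b i j : ZMod n} {x : Sym2 (ZMod n) → ZMod 2}

theorem SupportedAt.symm (hs : SupportedAt i j x) : SupportedAt j i x :=
  fun e h₁ h₂ => hs e h₂ h₁

theorem SupportedAt.eq_zero (hs : SupportedAt i j x) (hi : ∀ l, x s(i, l) = 0)
    (hj : ∀ l, x s(j, l) = 0) (e : Sym2 (ZMod n)) : x e = 0 := by
  by_cases h₁ : i ∈ e
  · obtain ⟨l, rfl⟩ := Sym2.mem_iff_exists.1 h₁
    exact hi l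
  · by_cases h₂ : j ∈ e
    · obtain ⟨l, rfl⟩ := Sym2.mem_iff_exists.1 h₂
      exact hj l
    · exact hs e h₁ h₂

theorem punctured_of_ne {k l : ZMod n} (hk : k ≠ b) (hl : l ≠ b) :
    punctured b x s(k, l) = x s(k, l) := by
  simp [punctured, hk.symm, hl.symm]

theorem punctured_right (k : ZMod n) : punctured b x s(k, b) = 0 := by simp [punctured]

theorem punctured_left (k : ZMod n) : punctured b x s(b, k) = 0 := by simp [punctured]

/-- If `x` is supported at `i` and `j`, a row check other than theirs has at most two terms. -/
theorem IsHalf.row_eq [NeZero n] (h : IsHalf a b x) (hij : i ≠ j)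
    (hs : SupportedAt i j x) {k : ZMod n}
    (ha : k ≠ a) (hb : k ≠ b) (hi : k ≠ i) (hj : k ≠ j) :
    (if i = a then 0 else x s(i, k)) + (if j = a then 0 else x s(j, k)) = 0 := by
  refine Eq.trans ?_ (h.row k ha hb)
  rw [← Finset.filter_ne' univ a, Finset.sum_filter,
    ← Finset.sum_subset (Finset.subset_univ {i, j}), Finset.sum_pair hij]
  · simp [Sym2.eq_swap (a := k)]
  · intro l _ hl
    have : x s(k, l) = 0 := hs _ (by grind) (by grind)
    simp [this]

theorem IsHalf.diag_sum [NeZero n] (h : IsHalf a b x) (m : ZMod n) :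
    ∑ e with e.add = m, punctured b x e + x s(a, b) = 0 := by
  rw [← h.diag m]
  simp only [Finset.sum_filter, punctured]
  congr 1
  refine Finset.sum_congr rfl fun e _ => ?_
  split_ifs <;> simp_all

theorem SupportedAt.punctured_eq_zero (hs : SupportedAt i j x) {m : ZMod n} {e : Sym2 (ZMod n)}
    (he : e.add = m) (h₁ : e ≠ s(i, m - i)) (h₂ : e ≠ s(j, m - j)) :
    punctured b x e = 0 := by
  have key : ∀ t : ZMod n, e ≠ s(t, m - t) → t ∉ e := by
    rintro t ht hte
    obtain ⟨l, rfl⟩ := Sym2.mem_iff_exists.1 hte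
    simp only [Sym2.add_mk] at he
    exact ht (by rw [← he]; simp)
  simp [punctured, hs e (key i h₁) (key j h₂)]

/-- If `x` is supported at `i` and `j`, a diagonal check has one term for each of `i` and `j`,
apart from the completing edge. -/
theorem IsHalf.diag_ne [NeZero n] (h : IsHalf a b x) (hij : i ≠ j)
    (hs : SupportedAt i j x) {m : ZMod n}
    (hm : m ≠ i + j) :
    punctured b x s(i, m - i) + punctured b x s(j, m - j) + x s(a, b) = 0 := by
  rw [← h.diag_sum m, ← Finset.sum_pair, Finset.sum_subset]
  · intro e; simp only [Finset.mem_insert, Finset.mem_singleton]; rintro (rfl | rfl) <;> simp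
  · intro e he hne
    simp only [Finset.mem_insert, Finset.mem_singleton, not_or] at hne
    exact hs.punctured_eq_zero (by simpa using he) hne.1 hne.2
  · intro h; rw [Sym2.eq_iff] at h; grind

/-- On the diagonal through the edge joining `i` and `j`, the two terms of `IsHalf.diag_ne`
are the same edge, which counts once. -/
theorem IsHalf.diag_eq [NeZero n] (h : IsHalf a b x) (hs : SupportedAt i j x) :
    punctured b x s(i, j) + x s(a, b) = 0 := by
  rw [← h.diag_sum (i + j), Finset.sum_eq_single s(i, j)]
  · intro e he hne
    refine hs.punctured_eq_zero (by simpa using he) (by simpa using hne) ?_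
    simpa [Sym2.eq_swap] using hne
  · simp

/-! ### Erasures that meet the punctured nodes -/

/-- Erasure of `a` and `b`: a half is determined up to its loop at `b`. -/
theorem IsHalf.loop_eq_zero_of_pair [NeZero n] (h : IsHalf a b x) (hab : a ≠ b)
    (hs : SupportedAt a b x) :
    x s(a, a) = 0 ∧ (x s(b, b) = 0 → ∀ e, x e = 0) := by
  have hc : x s(a, b) = 0 := by simpa [punctured_right] using h.diag_eq hs
  have hA : ∀ l, x s(a, l) = 0 := by
    intro l
    by_cases hl : l = b
    · rw [hl, hc]
    have := h.diag_ne hab hs (m := l + a) (by rwa [add_comm, Ne, add_right_inj])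
    simpa [punctured_left, hc, punctured_of_ne hab hl] using this
  refine ⟨hA a, fun hb => hs.eq_zero hA fun l => ?_⟩
  by_cases hl : l = b
  · rw [hl, hb]
  by_cases hl' : l = a
  · rw [hl', Sym2.eq_swap, hc]
  simpa [hab.symm] using h.row_eq hab hs hl' hl hl' hl

/-- Erasure of `a` and another node `i`: a half is determined up to its loop at `i`. -/
theorem IsHalf.eq_zero_of_left [NeZero n] (h : IsHalf a b x) (hab : a ≠ b) (ha : i ≠ a) (hb : i ≠ b)
    (hs : SupportedAt i a x) (hii : x s(i, i) = 0) : ∀ e, x e = 0 := by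
  have hf : ∀ k, k ≠ a → k ≠ b → x s(i, k) = 0 := by
    intro k hka hkb
    by_cases hki : k = i
    · rw [hki, hii]
    simpa [ha] using h.row_eq ha hs hka hkb hki hka
  have hib : x s(i, b) = 0 := by
    rw [← h.row i ha hb]
    symm
    refine Finset.sum_eq_single _ (fun l hl hlb => hf l (by simpa using hl) hlb) ?_
    simp [hab.symm]
  -- On the diagonal `a + b` the edges at `a` and `i` are `s(a, b)`, which is punctured, and
  -- `s(i, a + b - i)`, which is already known to vanish.
  have hc : x s(a, b) = 0 := by
    have := h.diag_ne ha hs (m := a + b) (by rwa [add_comm i, Ne, add_right_inj, eq_comm])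
    rw [punctured_of_ne hb (by grind), hf _ (by grind) (by grind)] at this
    simpa [punctured_right] using this
  have hia : x s(i, a) = 0 := by
    simpa [punctured_of_ne hb hab, hc] using h.diag_eq hs
  have hfi : ∀ k, x s(i, k) = 0 := by
    intro k
    by_cases hka : k = a
    · rw [hka, hia]
    by_cases hkb : k = b
    · rw [hkb, hib]
    exact hf k hka hkb
  refine hs.eq_zero hfi fun l => ?_
  by_cases hl : l = b
  · rw [hl, hc]
  by_cases hl' : l = i
  · rw [hl', Sym2.eq_swap, hia]
  have := h.diag_ne ha hs (m := l + a) (by rwa [Ne, add_left_inj])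
  have h0 : punctured b x s(i, l + a - i) = 0 := by simp [punctured, hfi]
  simpa [h0, hc, punctured_of_ne hab hl] using this

/-- Erasure of `b` and another node `i`: a half is determined up to its loop at `b`. -/
theorem IsHalf.loop_eq_zero_of_right [NeZero n] (h : IsHalf a b x) (hab : a ≠ b) (ha : i ≠ a)
    (hb : i ≠ b)
    (hs : SupportedAt i b x) : x s(i, i) = 0 ∧ (x s(b, b) = 0 → ∀ e, x e = 0) := by
  have hc : x s(a, b) = 0 := by simpa [punctured_right] using h.diag_eq hs
  have hf : ∀ k, k ≠ b → x s(i, k) = 0 := by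
    intro k hkb
    have := h.diag_ne hb hs (m := k + i) (by rwa [add_comm, Ne, add_right_inj])
    simpa [punctured_left, hc, punctured_of_ne hb hkb] using this
  have hib : x s(i, b) = 0 := by
    rw [← h.row i ha hb]
    symm
    refine Finset.sum_eq_single _ (fun l hl hlb => hf l hlb) ?_
    simp [hab.symm]
  have hfi : ∀ k, x s(i, k) = 0 := by
    intro k
    by_cases hkb : k = b
    · rw [hkb, hib]
    exact hf k hkb
  refine ⟨hf i hb, fun hbb => hs.eq_zero hfi fun l => ?_⟩
  by_cases hl : l = b
  · rw [hl, hbb]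
  by_cases hla : l = a
  · rw [hla, Sym2.eq_swap, hc]
  by_cases hl' : l = i
  · rw [hl', Sym2.eq_swap, hib]
  simpa [ha, hab.symm, hfi] using h.row_eq hb hs hla hl hl' hl

end

/-! ### Erasures that avoid the punctured nodes -/

theorem eq_of_constant_steps {α : Type*} {F : ℕ → α} {s r : ℕ} (hsr : s ≤ r)
    (h : ∀ t, s ≤ t → t < r → F (t + 1) = F t) : F r = F s := by
  induction r, hsr using Nat.le_induction with
  | base => rfl
  | succ r hr ih => rw [h r hr r.lt_succ_self, ih fun t h₁ h₂ => h t h₁ (by omega)]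

theorem progression_injective {n : ℕ} [Fact n.Prime] {j d : ZMod n} (hd : d ≠ 0) {s t : ℕ}
    (hs : s < n) (ht : t < n) (h : j + s * d = j + t * d) : s = t := by
  have h' : (s : ZMod n) = t := mul_right_cancel₀ hd (add_left_cancel h)
  rwa [ZMod.natCast_eq_natCast_iff', Nat.mod_eq_of_lt hs, Nat.mod_eq_of_lt ht] at h'

theorem exists_progression_eq {n : ℕ} [Fact n.Prime] (j : ZMod n) {d : ZMod n} (hd : d ≠ 0)
    (k : ZMod n) : ∃ t < n, j + (t : ℕ) * d = k :=
  ⟨((k - j) / d).val, ZMod.val_lt _, by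
    rw [ZMod.natCast_val, ZMod.cast_id, div_mul_cancel₀ _ hd]; ring⟩

/-- Erasure of two nodes other than `a` and `b`, which stand at the positions `P` and `Q` of the
progression from `j` with difference `i - j`: one of the loops at `i` and `j` vanishes, depending
on which of `a` and `b` comes first, and the half is determined up to the other loop. -/
theorem IsHalf.loop_eq_zero_of_avoiding {n : ℕ} [Fact n.Prime] {a b i j : ZMod n} {x : Sym2
    (ZMod n) → ZMod 2}
    (h : IsHalf a b x) (hab : a ≠ b) (hij : i ≠ j) (hs : SupportedAt i j x) (hia : i ≠ a)
    (hib : i ≠ b) (hja : j ≠ a) (hjb : j ≠ b) {P Q : ℕ} (hPn : P < n) (hQn : Q < n)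
    (hP : j + P * (i - j) = a) (hQ : j + Q * (i - j) = b) :
    (Q < P → x s(i, i) = 0) ∧ (P < Q → x s(j, j) = 0) ∧
      (x s(i, i) = 0 → x s(j, j) = 0 → ∀ e, x e = 0) := by
  have hn : n.Prime := Fact.out
  have hd : i - j ≠ 0 := sub_ne_zero.2 hij
  have hP1 : 1 < P := by
    rcases P with _ | _ | P
    · simp [hja] at hP
    · simp [hia] at hP
    · omega
  have hQ1 : 1 < Q := by
    rcases Q with _ | _ | P
    · simp [hjb] at hQ
    · simp [hib] at hQ
    · omega
  have hPQ : P ≠ Q := by rintro rfl; exact hab (hP.symm.trans hQ)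
  have hc : x s(a, b) = 0 :=
    hs _ (by simp [Sym2.mem_iff, hia, hib]) (by simp [Sym2.mem_iff, hja, hjb])
  set f : ZMod n → ZMod 2 := fun l => punctured b x s(i, l) with hf
  set g : ZMod n → ZMod 2 := fun l => punctured b x s(j, l) with hg
  have hfj : f j = 0 := by simpa [hc] using h.diag_eq hs
  have hgi : g i = 0 := by rw [← hfj]; simp only [hf, hg, Sym2.eq_swap]
  -- The diagonal checks: a shift by `i - j` carries the symbols at `i` to those at `j`.
  have hfg : ∀ l, g (l + (i - j)) = f l := by
    intro l
    by_cases hl : l = j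
    · rw [hl, hfj, add_sub_cancel, hgi]
    have := h.diag_ne hij hs (m := l + i) (by rwa [add_comm, Ne, add_right_inj])
    rw [hc, add_zero, add_sub_cancel_right, CharTwo.add_eq_zero] at this
    rw [hf, hg]
    simp only [this]
    congr 2; ring_nf
  -- The row checks; at `b`, where there is none, both sides are punctured.
  have hrow : ∀ l, l ≠ i → l ≠ j → l ≠ a → f l = g l := by
    intro l hi hj ha
    by_cases hb : l = b
    · simp only [hf, hg, hb, punctured_right]
    simp only [hf, hg, punctured_of_ne hib hb, punctured_of_ne hjb hb]
    simpa [hia, hja, CharTwo.add_eq_zero] using h.row_eq hij hs ha hb hi hj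
  set F : ℕ → ZMod 2 := fun t => f (j + t * (i - j)) with hF
  -- Along the progression `f` changes only on entering `j` (`t = 0`), `i` (`t = 1`) and `a`.
  have hstep : ∀ t, 1 ≤ t → t + 1 < n → t + 1 ≠ P → F (t + 1) = F t := by
    intro t ht htn htP
    have e1 : j + ((t + 1 : ℕ) : ZMod n) * (i - j) = j + t * (i - j) + (i - j) := by
      push_cast; ring
    have h1 := hrow (j + ((t + 1 : ℕ) : ZMod n) * (i - j))
      (fun h => by
        have := progression_injective (j := j) hd htn (t := 1) hn.one_lt (by simpa using h)
        omega)
      (fun h => by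
        have := progression_injective (j := j) hd htn (t := 0) hn.pos (by simpa using h)
        omega)
      (fun h => htP (progression_injective hd htn hPn (h.trans hP.symm)))
    simp only [hF]
    rw [h1, e1, hfg]
  have hF1 : F 1 = x s(i, i) := by
    simp only [hF, hf, Nat.cast_one, one_mul, add_sub_cancel, punctured_of_ne hib hib]
  have hFl : F (n - 1) = x s(j, j) := by
    rw [← punctured_of_ne (x := x) hjb hjb]
    change _ = g j
    have e1 : j = (j + ((n - 1 : ℕ) : ZMod n) * (i - j)) + (i - j) := by
      rw [Nat.cast_sub hn.one_le]; simp; ring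
    rw [e1, hfg]
  have hFQ : F Q = 0 := by simp only [hF, hQ, hf, punctured_right]
  have hlow : ∀ t, 1 ≤ t → t < P → F t = F 1 := fun t h₁ h₂ =>
    eq_of_constant_steps h₁ fun u h₃ h₄ => hstep u h₃ (by omega) (by omega)
  have hhigh : ∀ t, P ≤ t → t < n → F (n - 1) = F t := fun t h₁ h₂ =>
    eq_of_constant_steps (by omega) fun u h₃ h₄ => hstep u (by omega) (by omega) (by omega)
  refine ⟨fun hlt => ?_, fun hlt => ?_, fun hii hjj => ?_⟩
  · rw [← hF1, ← hlow Q (by omega) hlt, hFQ]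
  · rw [← hFl, hhigh Q hlt.le hQn, hFQ]
  have hFz : ∀ t < n, F t = 0 := by
    intro t ht
    rcases Nat.eq_zero_or_pos t with rfl | h0
    · simpa [hF] using hfj
    rcases lt_or_ge t P with h1 | h1
    · rw [hlow t h0 h1, hF1, hii]
    · rw [← hhigh t h1 ht, hFl, hjj]
  have hfz : ∀ l, f l = 0 := by
    intro l
    obtain ⟨t, ht, rfl⟩ := exists_progression_eq j hd l
    exact hFz t ht
  have hgz : ∀ l, g l = 0 := by
    intro l
    rw [← sub_add_cancel l (i - j), hfg, hfz]
  -- The diagonals ignore the edge from `i` (or `j`) to `b`; its own row check settles it.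
  have unpunctured : ∀ k, k ≠ a → k ≠ b → (∀ l, punctured b x s(k, l) = 0) →
    ∀ l, x s(k, l) = 0 := by
    intro k hka hkb hk
    have hne : ∀ l, l ≠ b → x s(k, l) = 0 := fun l hl => by
      rw [← punctured_of_ne (x := x) hkb hl, hk]
    intro l
    by_cases hl : l = b
    · rw [hl, ← h.row k hka hkb]
      symm
      exact Finset.sum_eq_single _ (fun l _ hlb => hne l hlb) (by simp [hab.symm])
    · exact hne l hl
  exact hs.eq_zero (unpunctured i hia hib hfz) (unpunctured j hja hjb hgz)

/-- Two labelings that satisfy the check system and its exchange, agree on the loops and are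
supported at two nodes vanish: the loop that one of them leaves undetermined is zero in the other. -/
theorem IsHalf.eq_zero_of_coupled {n : ℕ} [Fact n.Prime] {a b i j : ZMod n}
    {x y : Sym2 (ZMod n) → ZMod 2} (hx : IsHalf a b x) (hy : IsHalf b a y)
    (hxy : ∀ k, x s(k, k) = y s(k, k)) (hab : a ≠ b) (hij : i ≠ j) (hsx : SupportedAt i j x)
    (hsy : SupportedAt i j y) : (∀ e, x e = 0) ∧ ∀ e, y e = 0 := by
  have of_left : ∀ {a b i : ZMod n} {x y : Sym2 (ZMod n) → ZMod 2}, IsHalf a b x → IsHalf b a y →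
      (∀ k, x s(k, k) = y s(k, k)) → a ≠ b → i ≠ a → i ≠ b → SupportedAt i a x →
      SupportedAt i a y → (∀ e, x e = 0) ∧ ∀ e, y e = 0 := by
    intro a b i x y hx hy hxy hab hia hib hsx hsy
    obtain ⟨h1, h2⟩ := hy.loop_eq_zero_of_right hab.symm hib hia hsy
    have h3 := hx.eq_zero_of_left hab hia hib hsx (by rw [hxy, h1])
    exact ⟨h3, h2 (by rw [← hxy, h3])⟩
  have of_pair : SupportedAt a b x → SupportedAt a b y → (∀ e, x e = 0) ∧ ∀ e, y e = 0 := by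
    intro hsx hsy
    obtain ⟨h1, h2⟩ := hx.loop_eq_zero_of_pair hab hsx
    obtain ⟨h3, h4⟩ := hy.loop_eq_zero_of_pair hab.symm hsy.symm
    exact ⟨h2 (by rw [hxy, h3]), h4 (by rw [← hxy, h1])⟩
  by_cases hia : i = a
  · subst hia
    by_cases hjb : j = b
    · subst hjb
      exact of_pair hsx hsy
    · exact of_left hx hy hxy hab hij.symm hjb hsx.symm hsy.symm
  by_cases hib : i = b
  · subst hib
    by_cases hja : j = a
    · subst hja
      exact of_pair hsx.symm hsy.symm
    · exact (of_left hy hx (fun k => (hxy k).symm) hab.symm hij.symm hja hsy.symm hsx.symm).symm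
  by_cases hja : j = a
  · subst hja
    exact of_left hx hy hxy hab hia hib hsx hsy
  by_cases hjb : j = b
  · subst hjb
    exact (of_left hy hx (fun k => (hxy k).symm) hab.symm hib hia hsy hsx).symm
  have hd : i - j ≠ 0 := sub_ne_zero.2 hij
  obtain ⟨P, hPn, hP⟩ := exists_progression_eq j hd a
  obtain ⟨Q, hQn, hQ⟩ := exists_progression_eq j hd b
  obtain ⟨x1, x2, x3⟩ := hx.loop_eq_zero_of_avoiding hab hij hsx hia hib hja hjb hPn hQn hP hQ
  obtain ⟨y1, y2, y3⟩ := hy.loop_eq_zero_of_avoiding hab.symm hij hsy hib hia hjb hja hQn hPn hQ hP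
  have hPQ : P ≠ Q := by rintro rfl; exact hab (hP.symm.trans hQ)
  have key : x s(i, i) = 0 ∧ x s(j, j) = 0 := by
    rcases lt_or_gt_of_ne hPQ with h | h
    · exact ⟨by rw [hxy, y1 h], x2 h⟩
    · exact ⟨x1 h, by rw [hxy, y2 h]⟩
  exact ⟨x3 key.1 key.2, y3 (by rw [← hxy, key.1]) (by rw [← hxy, key.2])⟩

/-! ### From the code to its two halves -/

/-- The node `v_i` as the residue of `i` modulo `n`. -/
def residue (n : ℕ) [NeZero n] : Fin n ≃ ZMod n where
  toFun i := (i : ℕ)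
  invFun k := ⟨k.val, k.val_lt⟩
  left_inv i := Fin.ext (ZMod.val_cast_of_lt i.isLt)
  right_inv k := ZMod.natCast_zmod_val k

theorem residue_add_eq_iff {n : ℕ} [NeZero n] (k l m : Fin n) :
    residue n k + residue n l = residue n m ↔ ((k : ℕ) + l) % n = m := by
  simp only [residue, Equiv.coe_fn_mk]
  rw [← Nat.cast_add, ZMod.natCast_eq_natCast_iff', Nat.mod_eq_of_lt m.isLt]

theorem isHalf_comp_residue {n : ℕ} [NeZero n] {A B : Fin n} {w : Sym2 (Fin n) → ZMod 2}
    (hrow : ∀ h, h ≠ A → h ≠ B → ∑ l ∈ univ.erase A, w s(h, l) = 0)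
    (hdiag : ∀ m, ∑ e ∈ insert s(A, B) (univ.filter fun e : Sym2 (Fin n) =>
      B ∉ e ∧ (e.map (residue n)).add = residue n m), w e
      = 0) :
    IsHalf (residue n A) (residue n B) fun e => w (e.map (residue n).symm) := by
  constructor
  · intro h ha hb
    rw [← hrow ((residue n).symm h) (by rwa [Ne, Equiv.symm_apply_eq])
      (by rwa [Ne, Equiv.symm_apply_eq])]
    refine Finset.sum_equiv (residue n).symm (fun l => ?_) fun l _ => rfl
    simp [Equiv.symm_apply_eq]
  · intro m
    rw [← hdiag ((residue n).symm m), Finset.sum_insert (by simp), add_comm]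
    congr 1
    · simp
    · refine Finset.sum_nbij' (Sym2.map (residue n).symm) (Sym2.map (residue n)) (fun e => ?_)
        (fun e => ?_) (fun e _ => ?_) (fun e _ => ?_) fun e _ => rfl <;>
      · induction e
        simp [Equiv.eq_symm_apply]

theorem down_injective {n : ℕ} : Function.Injective (down (n := n)) := fun _ _ h =>
  Sym2.inf_eq_inf_and_sup_eq_sup.1 ⟨congrArg Prod.snd h, congrArg Prod.fst h⟩

theorem up_injective {n : ℕ} : Function.Injective (up (n := n)) := fun _ _ h =>
  Sym2.inf_eq_inf_and_sup_eq_sup.1 ⟨congrArg Prod.fst h, congrArg Prod.snd h⟩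

theorem down_self {n : ℕ} (k : Fin n) : down s(k, k) = (k, k) := by simp [down]

theorem up_self {n : ℕ} (k : Fin n) : up s(k, k) = (k, k) := by simp [up]

theorem down_or_up {n : ℕ} (k l : Fin n) : down s(k, l) = (k, l) ∨ up s(k, l) = (k, l) := by
  rcases le_total k l with h | h
  · right; simp [up, h]
  · left; simp [down, h]

/-- The node `v_{n-1}`. -/
def lastNode (n : ℕ) [NeZero n] : Fin n := ⟨n - 1, Nat.sub_lt (NeZero.pos n) one_pos⟩

/-- The node `v_{n-2}`. -/
def penultimateNode (n : ℕ) [NeZero n] : Fin n := ⟨n - 2, Nat.sub_lt (NeZero.pos n) two_pos⟩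

section
variable {n : ℕ} [NeZero n]

theorem lastNode_ne_penultimateNode (hn : 2 ≤ n) : lastNode n ≠ penultimateNode n := by
  simp only [lastNode, penultimateNode, Ne, Fin.mk.injEq]; omega

theorem eq_lastNode_iff (k : Fin n) : k = lastNode n ↔ (k : ℕ) = n - 1 := Fin.ext_iff

theorem eq_penultimateNode_iff (k : Fin n) : k = penultimateNode n ↔ (k : ℕ) = n - 2 :=
  Fin.ext_iff

theorem ne_sub_two_iff (k : Fin n) : (k : ℕ) ≠ n - 2 ↔ k ≠ penultimateNode n :=
  (eq_penultimateNode_iff k).not.symm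

theorem lt_sub_one_iff (k : Fin n) : (k : ℕ) < n - 1 ↔ k ≠ lastNode n := by
  rw [Ne, eq_lastNode_iff]; omega

theorem S_eq (h : Fin n) : S h = (univ.erase (lastNode n)).image fun l => s(h, l) := by
  simp only [S, lt_sub_one_iff, Finset.filter_ne']

theorem S'_eq (h : Fin n) : S' h = (univ.erase (penultimateNode n)).image fun l => s(h, l) := by
  simp only [S', ne_sub_two_iff, Finset.filter_ne']

theorem D_eq (m : Fin n) :
    D m = insert s(lastNode n, penultimateNode n)
      (univ.filter fun e : Sym2 (Fin n) =>
        penultimateNode n ∉ e ∧ (e.map (residue n)).add = residue n m) := by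
  ext e
  induction e with | _ k l =>
  simp only [D, ne_sub_two_iff, ← eq_penultimateNode_iff, ← eq_lastNode_iff, Finset.mem_image,
    Finset.mem_union,
    Finset.mem_filter_univ, Finset.mem_insert, Sym2.map_mk, Sym2.add_mk, residue_add_eq_iff,
    Sym2.mem_iff, Prod.exists, Sym2.eq_iff]
  grind

theorem D'_eq (m : Fin n) :
    D' m = insert s(penultimateNode n, lastNode n)
      (univ.filter fun e : Sym2 (Fin n) =>
        lastNode n ∉ e ∧ (e.map (residue n)).add = residue n m) := by
  ext e
  induction e with | _ k l =>
  simp only [D', ← eq_penultimateNode_iff, lt_sub_one_iff, ← eq_lastNode_iff, Finset.mem_image,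
    Finset.mem_union, Finset.mem_filter_univ, Finset.mem_insert, Sym2.map_mk, Sym2.add_mk,
    residue_add_eq_iff, Sym2.mem_iff, Prod.exists, Sym2.eq_iff]
  grind

theorem isHalf_down {L : LabeledGraph n (ZMod 2)} (hL : L ∈ codeG4 n) :
    IsHalf (residue n (lastNode n)) (residue n (penultimateNode n))
      fun e => L (down (e.map (residue n).symm)) := by
  refine isHalf_comp_residue (w := fun e => L (down e)) (fun h ha hb => ?_) fun m => ?_
  · rw [Ne, eq_lastNode_iff] at ha
    rw [Ne, eq_penultimateNode_iff] at hb
    rw [← hL.1 h (by omega), Sdown, Finset.sum_image down_injective.injOn, S_eq,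
      Finset.sum_image fun _ _ _ _ => Sym2.congr_right.1]
  · rw [← hL.2.1 m, Ddown, Finset.sum_image down_injective.injOn, D_eq]

theorem isHalf_up {L : LabeledGraph n (ZMod 2)} (hL : L ∈ codeG4 n) :
    IsHalf (residue n (penultimateNode n)) (residue n (lastNode n))
      fun e => L (up (e.map (residue n).symm)) := by
  refine isHalf_comp_residue (w := fun e => L (up e)) (fun h hb ha => ?_) fun m => ?_
  · rw [Ne, eq_lastNode_iff] at ha
    rw [Ne, eq_penultimateNode_iff] at hb
    rw [← hL.2.2.1 h (by omega), GraphCode.Sup, Finset.sum_image up_injective.injOn, S'_eq,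
      Finset.sum_image fun _ _ _ _ => Sym2.congr_right.1]
  · rw [← hL.2.2.2 m, Dup, Finset.sum_image up_injective.injOn, D'_eq]

end

/-! ### Erasure correction -/

theorem mem_biUnion_neighborhood {n : ℕ} {F : Finset (Fin n)} {k l : Fin n} :
    (k, l) ∈ F.biUnion neighborhood ↔ k ∈ F ∨ l ∈ F := by
  simp [neighborhood, eq_comm]
  grind

/-- A codeword that vanishes on all edges avoiding two given nodes is zero. -/
theorem eq_zero_of_mem_codeG4 {n : ℕ} (hn : n.Prime) {F : Finset (Fin n)} (hF : F.card = 2)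
    {L : LabeledGraph n (ZMod 2)} (hL : L ∈ codeG4 n)
    (h0 : ∀ k l, k ∉ F → l ∉ F → L (k, l) = 0) : L = 0 := by
  have : Fact n.Prime := ⟨hn⟩
  obtain ⟨i, j, hij, rfl⟩ := Finset.card_eq_two.1 hF
  have hs : ∀ e : Sym2 (ZMod n), residue n i ∉ e → residue n j ∉ e →
      L (down (e.map (residue n).symm)) = 0 ∧ L (up (e.map (residue n).symm)) = 0 := by
    intro e hi hj
    induction e with | _ k l =>
    simp only [Sym2.mem_iff, not_or, ← Equiv.eq_symm_apply] at hi hj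
    simp only [Sym2.map_mk]
    rcases le_total ((residue n).symm k) ((residue n).symm l) with h | h <;>
    · simp only [down, up, Sym2.sup_mk, Sym2.inf_mk, h, sup_of_le_left, sup_of_le_right,
        inf_of_le_left, inf_of_le_right]
      constructor <;> apply h0 <;> grind
  obtain ⟨hx, hy⟩ := (isHalf_down hL).eq_zero_of_coupled (isHalf_up hL)
    (fun k => by simp only [Sym2.map_mk, down_self, up_self])
    ((residue n).injective.ne (lastNode_ne_penultimateNode hn.two_le))
    ((residue n).injective.ne hij) (fun e hi hj => (hs e hi hj).1) fun e hi hj => (hs e hi hj).2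
  funext ⟨k, l⟩
  have hx' := hx s(residue n k, residue n l)
  have hy' := hy s(residue n k, residue n l)
  simp only [Sym2.map_mk, Equiv.symm_apply_apply] at hx' hy'
  rcases down_or_up k l with h | h
  · rwa [h] at hx'
  · rwa [h] at hy'

/-- All parity checks of the code, as one linear map whose kernel is the code. -/
def parityCheck (n : ℕ) :
    LabeledGraph n (ZMod 2) →ₗ[ZMod 2]
      ({h : Fin n // (h : ℕ) < n - 2} → ZMod 2) × (Fin n → ZMod 2) ×
        ({h : Fin n // (h : ℕ) < n - 2} → ZMod 2) × (Fin n → ZMod 2) where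
  toFun L := (fun h => ∑ e ∈ Sdown h.1, L e, fun m => ∑ e ∈ Ddown m, L e,
    fun h => ∑ e ∈ GraphCode.Sup h.1, L e, fun m => ∑ e ∈ Dup m, L e)
  map_add' L M := by ext <;> simp [Finset.sum_add_distrib]
  map_smul' c L := by ext <;> simp [Finset.mul_sum]

theorem coe_ker_parityCheck (n : ℕ) :
    (LinearMap.ker (parityCheck n) : Set (LabeledGraph n (ZMod 2))) = codeG4 n := by
  ext L
  simp [parityCheck, codeG4, funext_iff]

theorem sub_mem_codeG4 {n : ℕ} {G H : LabeledGraph n (ZMod 2)} (hG : G ∈ codeG4 n)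
    (hH : H ∈ codeG4 n) : G - H ∈ codeG4 n := by
  rw [← coe_ker_parityCheck] at *
  exact sub_mem hG hH

theorem isNodeErasureCorrecting_codeG4 {n : ℕ} (hn : n.Prime) :
    IsNodeErasureCorrecting 2 (codeG4 n) := by
  intro F hF
  have inj : Set.InjOn (fail F) (codeG4 n) := by
    intro G hG H hH h
    refine sub_eq_zero.1 (eq_zero_of_mem_codeG4 hn hF (sub_mem_codeG4 hG hH) fun k l hk hl => ?_)
    have := congrFun h (k, l)
    simpa [fail, mem_biUnion_neighborhood, -Finset.mem_biUnion, hk, hl, sub_eq_zero] using this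
  exact ⟨Function.invFunOn (fail F) (codeG4 n), fun G hG => inj.leftInvOn_invFunOn hG⟩

/-! ### Dimension -/

theorem finrank_ker_parityCheck {n : ℕ} (hn : n.Prime) :
    Module.finrank (ZMod 2) (LinearMap.ker (parityCheck n)) = (n - 2) ^ 2 := by
  have hcard : Fintype.card {h : Fin n // (h : ℕ) < n - 2} = n - 2 := by
    rw [Fintype.card_subtype, Fin.card_filter_val_lt]; omega
  apply le_antisymm
  -- Restriction to the edges avoiding two nodes is injective on the code.
  · obtain ⟨F, -, hF⟩ := Finset.exists_subset_card_eq (s := (univ : Finset (Fin n))) (n := 2)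
      (by simpa using hn.two_le)
    let r : LabeledGraph n (ZMod 2) →ₗ[ZMod 2] ({k // k ∉ F} × {k // k ∉ F} → ZMod 2) :=
      LinearMap.funLeft (ZMod 2) (ZMod 2) fun p => (p.1.1, p.2.1)
    have inj : Function.Injective (r.domRestrict (LinearMap.ker (parityCheck n))) := by
      rw [← LinearMap.ker_eq_bot, LinearMap.ker_eq_bot']
      rintro ⟨L, hL⟩ h
      rw [← SetLike.mem_coe, coe_ker_parityCheck] at hL
      exact Subtype.ext (eq_zero_of_mem_codeG4 hn hF hL fun k l hk hl =>
        congrFun h (⟨k, hk⟩, ⟨l, hl⟩))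
    refine (LinearMap.finrank_le_finrank_of_injective inj).trans_eq ?_
    simp [Module.finrank_fintype_fun_eq_card, Fintype.card_subtype_compl, hF, sq]
  -- Rank-nullity, with the rank at most the number `4 * n - 4` of checks.
  · have h1 := LinearMap.finrank_range_add_finrank_ker (parityCheck n)
    have h2 := Submodule.finrank_le (LinearMap.range (parityCheck n))
    simp only [Module.finrank_prod, Module.finrank_fintype_fun_eq_card, hcard, Fintype.card_fin,
      Fintype.card_prod] at h1 h2
    obtain ⟨k, rfl⟩ := Nat.exists_eq_add_of_le' hn.two_le
    simp only [Nat.add_sub_cancel] at *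
    nlinarith

theorem dimension_codeG4 {n : ℕ} (hn : n.Prime) : dimension (codeG4 n) = ((n : ℝ) - 2) ^ 2 := by
  have hcard : (codeG4 n).ncard = 2 ^ (n - 2) ^ 2 := by
    rw [← coe_ker_parityCheck, ← Nat.card_coe_set_eq, ← finrank_ker_parityCheck hn]
    simpa using Module.natCard_eq_pow_finrank (K := ZMod 2) (V := LinearMap.ker (parityCheck n))
  rw [dimension, hcard, Nat.card_zmod]
  push_cast
  rw [Real.logb_pow, Real.logb_self_eq_one one_lt_two]
  push_cast [Nat.cast_sub hn.two_le]
  ring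

end GraphCode

theorem mainTheorem1 (n : ℕ) (hn : n.Prime) (hn5 : 5 ≤ n) :
    GraphCode.IsOptimalNodeErasureCorrecting 2 (GraphCode.codeG4 n) ∧
      GraphCode.redundancy (GraphCode.codeG4 n) = 4 * (n : ℝ) - 4 ∧
      GraphCode.dimension (GraphCode.codeG4 n) = ((n : ℝ) - 2) ^ 2 := by
  have hdim := GraphCode.dimension_codeG4 hn
  refine ⟨⟨GraphCode.isNodeErasureCorrecting_codeG4 hn, ?_⟩, ?_, hdim⟩
  · rw [GraphCode.redundancy, hdim, Nat.cast_ofNat]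
  · rw [GraphCode.redundancy, hdim]
    ring
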